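/- An (a,b)-module is a free $\mathbb{C}[[b]]$-module $E$ of finite type with a $\mathbb{C}$-linear endomorphism $a$, continuous for the $b$-adic topology, such that $ab-ba=b^2$. Morphisms are the $\mathbb{C}[[b]]$-linear maps commuting with $a$. $E$ has a simple pole if $aE\subset bE$; then $S(E)\subset\mathbb{C}$ denotes the spectrum of the endomorphism of $E/bE$ induced by $b^{-1}a$. $E$ is regular if its saturation by $b^{-1}a$ in $E[b^{-1}]$ is finitely generated over $\mathbb{C}[[b]]$. For $\lambda\in\mathbb{C}$, $E_\lambda=\mathbb{C}[[b]]e_\lambda$ with $a e_\lambda=\lambda b e_\lambda$. The dual $E^*$ is $\mathrm{Hom}_{\mathbb{C}[[b]]}(E,E_0)$, where $S(b)\in\mathbb{C}[[b]]$ acts as multiplication by $S(-b)$ and $(a\varphi)(e)=\varphi(ae)-a\varphi(e)$. For a class $\tilde\lambda\in\mathbb{C}/\mathbb{Z}$, ordered by real parts, put $$\tilde\lambda_{min}(E)=\inf\{\lambda\in\tilde\lambda : \exists \text{ a non zero morphism } E_\lambda\to E\},\qquad \tilde\lambda_{max}(E)=\sup\{\lambda\in\tilde\lambda : \exists \text{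 a non zero morphism } E\to E_\lambda\},$$ with $\inf\emptyset=+\infty$, $\sup\emptyset=-\infty$ (and $\inf=-\infty$, resp. $\sup=+\infty$, for a set not bounded below, resp. above), $L_{\tilde\lambda}(E)=\tilde\lambda_{max}(E)-\tilde\lambda_{min}(E)$, and $L(E)=\sup_{\tilde\lambda\in\mathbb{C}/\mathbb{Z}}L_{\tilde\lambda}(E)$, with the conventions $-\infty-x=-\infty$ for $x\in\,]-\infty,+\infty]$ and $+\infty-x=+\infty$ for $x\in[-\infty,+\infty[$. Lemma. 1. If $E$ is a simple pole (a,b)-module then, for every $\tilde\lambda\in\mathbb{C}/\mathbb{Z}$, $$\tilde\lambda_{min}(E)=\inf\,(S(E)\cap\tilde\lambda)\quad\text{and}\quad\tilde\lambda_{max}(E)=\sup\,(S(E)\cap\tilde\lambda).$$ 2. If $E$ is a regular (a,b)-module then, for every $\tilde\lambda\in\mathbb{C}/\mathbb{Z}$, $$\widetilde{(-\lambda)}_{max}(E^*)=-\tilde\lambda_{min}(E),\qquad \widetilde{(-\lambda)}_{min}(E^*)=-\tilde\lambda_{max}(E),$$ hence $L_{-\tilde\lambda}(E^*)=L_{\tilde\lambda}(E)$;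 and $L(E^*)=L(E)$. 3. If $E$ is a regular (a,b)-module then, for every $\tilde\lambda\in\mathbb{C}/\mathbb{Z}$, $\tilde\lambda_{min}(E)\neq-\infty$, $\tilde\lambda_{max}(E)\neq+\infty$, and $$\tilde\lambda_{min}(E)\neq+\infty\iff\tilde\lambda_{max}(E)\neq-\infty.$$ In particular $\tilde\lambda_{min}(E)$ is finite if and only if $\tilde\lambda_{max}(E)$ is finite. -/

import Mathlib

open scoped PowerSeries

noncomputable section

set_option linter.unusedSectionVars false

namespace AB

open PowerSeries

/-! ### (a,b)-modules -/

/-- An (a,b)-module: a free `ℂ⟦b⟧`-module of finite type with a `ℂ`-linear endomorphism `a`,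
continuous for the `b`-adic topology, with `a b - b a = b²`. The variable `b` is
`PowerSeries.X`, acting by scalar multiplication. -/
class ABModule (E : Type*) [AddCommGroup E] [Module ℂ E] [Module ℂ⟦X⟧ E]
    [IsScalarTower ℂ ℂ⟦X⟧ E] where
  free : Module.Free ℂ⟦X⟧ E
  finite : Module.Finite ℂ⟦X⟧ E
  /-- the operator `a` -/
  a : E →ₗ[ℂ] E
  /-- continuity of the linear map `a` at `0` for the `b`-adic topology -/
  continuous_a : ∀ n : ℕ, ∃ m : ℕ, ∀ x : E, ∃ y : E,
    a ((X : ℂ⟦X⟧) ^ m • x) = (X : ℂ⟦X⟧) ^ n • y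
  commutation : ∀ x : E,
    a ((X : ℂ⟦X⟧) • x) - (X : ℂ⟦X⟧) • a x = (X : ℂ⟦X⟧) ^ 2 • x

attribute [instance] ABModule.free ABModule.finite

section ModuleIdentities

variable {R M : Type*} [CommRing R] [AddCommGroup M] [Module R M]

theorem mod_aux1 (b m : R) (n : ℕ) (u v : M) :
    b ^ n • (b ^ 2 • v + b • u) + (m * b ^ (n + 1)) • b • v
      = b ^ (n + 1) • u + ((m + 1) * b ^ (n + 1 + 1)) • v := by module

theorem mod_aux2 (b m : R) (n : ℕ) (u v : M) :
    b ^ n • u + (m * b ^ (n + 1)) • v = b ^ n • (u + (m * b) • v) := by module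

theorem mod_aux3 (p q d e : R) (u v : M) :
    p • u + d • v + (q • u + e • v) = (p + q) • u + (d + e) • v := by module

theorem mod_aux4 (b m q d T U : R) (n : ℕ) (u v w : M) :
    q • u + d • v + (b ^ n • w + (m * b ^ (n + 1)) • T • v)
        - (q • u + (b ^ n * T) • u + (d + b ^ n * U) • v)
      = b ^ n • (w + (m * b) • T • v - T • u - U • v) := by module

theorem mod_aux5 (S d : R) (u v w : M) :
    S • u + d • v - (S • w + d • v) = S • (u - w) := by module

theorem mod_aux6 (b : R) (u v w : M) :
    (-b) • u - ((-b) • w + (b ^ 2 * -1) • v) - (-b) • (u - w) = (-b) ^ 2 • v := by module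

theorem mod_aux7 (b : R) (u v : M) : b • (u + b • v) = b ^ 2 • v + b • u := by module

theorem mod_aux8 (b s t ds dt : R) (u v x y : M) (h0 : t • x = s • y)
    (h1 : t • u + (b * dt) • x = s • v + (b * ds) • y) :
    (t * t) • (s • u - (b * ds) • x) = (s * s) • (t • v - (b * dt) • y) := by
  have e : (t * t) • (s • u - (b * ds) • x) - (s * s) • (t • v - (b * dt) • y)
      = (t * s) • (t • u + (b * dt) • x - (s • v + (b * ds) • y))
        - (s * b * dt + t * b * ds) • (t • x - s • y) := by module
  rw [← sub_eq_zero, e, h0, h1, sub_self, sub_self, smul_zero, smul_zero, sub_zero]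

end ModuleIdentities

section Leibniz

variable {E : Type*} [AddCommGroup E] [Module ℂ E] [Module ℂ⟦X⟧ E] [IsScalarTower ℂ ℂ⟦X⟧ E]

theorem map_X_pow_smul (a : E →ₗ[ℂ] E)
    (h : ∀ x : E, a ((X : ℂ⟦X⟧) • x) - (X : ℂ⟦X⟧) • a x = (X : ℂ⟦X⟧) ^ 2 • x)
    (n : ℕ) (x : E) :
    a ((X : ℂ⟦X⟧) ^ n • x) = (X : ℂ⟦X⟧) ^ n • a x + ((n : ℂ⟦X⟧) * X ^ (n + 1)) • x := by
  induction n generalizing x with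
  | zero => simp
  | succ n ih =>
    have h' := h x
    rw [sub_eq_iff_eq_add] at h'
    rw [pow_succ, mul_smul, ih, h', ← pow_succ, Nat.cast_succ, mod_aux1]

theorem continuous_of_commutation (a : E →ₗ[ℂ] E)
    (h : ∀ x : E, a ((X : ℂ⟦X⟧) • x) - (X : ℂ⟦X⟧) • a x = (X : ℂ⟦X⟧) ^ 2 • x) (n : ℕ) :
    ∃ m : ℕ, ∀ x : E, ∃ y : E, a ((X : ℂ⟦X⟧) ^ m • x) = (X : ℂ⟦X⟧) ^ n • y := by
  refine ⟨n, fun x => ⟨a x + ((n : ℂ⟦X⟧) * X) • x, ?_⟩⟩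
  rw [map_X_pow_smul a h, mod_aux2]

theorem eq_zero_of_forall_X_pow [Module.Free ℂ⟦X⟧ E] (z : E)
    (h : ∀ n : ℕ, ∃ y : E, z = (X : ℂ⟦X⟧) ^ n • y) : z = 0 := by
  let B := Module.Free.chooseBasis ℂ⟦X⟧ E
  apply B.repr.injective
  ext i k
  obtain ⟨y, hy⟩ := h (k + 1)
  rw [hy]
  simp [coeff_X_pow_mul']

variable [ABModule E]

theorem a_smul (S : ℂ⟦X⟧) (x : E) :
    ABModule.a (S • x) = S • ABModule.a x + (X ^ 2 * derivative ℂ S) • x := by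
  have key := map_X_pow_smul (E := E) ABModule.a ABModule.commutation
  have hpoly : ∀ p : Polynomial ℂ, ∀ x : E,
      ABModule.a ((p : ℂ⟦X⟧) • x)
        = (p : ℂ⟦X⟧) • ABModule.a x + (X ^ 2 * derivative ℂ (p : ℂ⟦X⟧)) • x := by
    intro p x
    induction p using Polynomial.induction_on' with
    | add p q hp hq =>
      rw [Polynomial.coe_add, add_smul, map_add, hp, hq, map_add, mul_add, mod_aux3]
    | monomial n c =>
      have e : ((Polynomial.monomial n c : Polynomial ℂ) : ℂ⟦X⟧) = c • (X : ℂ⟦X⟧) ^ n := by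
        rw [Polynomial.coe_monomial, X_pow_eq, ← map_smul, smul_eq_mul, mul_one]
      rw [e, smul_assoc, map_smul, key, Derivation.map_smul, derivative_pow, derivative_X,
        smul_add, smul_assoc, mul_smul_comm, smul_assoc]
      congr 3
      rcases n with _ | n
      · simp
      · simp only [Nat.add_sub_cancel]; ring
  rw [← sub_eq_zero]
  apply eq_zero_of_forall_X_pow
  intro n
  obtain ⟨T, hT⟩ : ∃ T : ℂ⟦X⟧, S = (trunc n S : ℂ⟦X⟧) + X ^ n * T := by
    have : (X : ℂ⟦X⟧) ^ n ∣ S - (trunc n S : ℂ⟦X⟧) := by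
      rw [X_pow_dvd_iff]
      intro m hm
      simp [coeff_trunc, hm]
    obtain ⟨T, hT⟩ := this
    exact ⟨T, by rw [← hT]; ring⟩
  refine ⟨ABModule.a (T • x) + ((n : ℂ⟦X⟧) * X) • (T • x) - T • ABModule.a x
    - ((n : ℂ⟦X⟧) * X * T + X ^ 2 * derivative ℂ T) • x, ?_⟩
  have e2 : (X : ℂ⟦X⟧) ^ 2 * ((n : ℂ⟦X⟧) * X ^ (n - 1)) = X ^ n * ((n : ℂ⟦X⟧) * X) := by
    rcases n with _ | n
    · simp
    · simp only [Nat.add_sub_cancel]; ring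
  have e3 : (X : ℂ⟦X⟧) ^ 2 * derivative ℂ ((X : ℂ⟦X⟧) ^ n * T)
      = X ^ n * ((n : ℂ⟦X⟧) * X * T + X ^ 2 * derivative ℂ T) := by
    rw [Derivation.leibniz, derivative_pow, derivative_X, smul_eq_mul, smul_eq_mul]
    linear_combination T * e2
  have e4 : (X ^ 2 * derivative ℂ S : ℂ⟦X⟧) = X ^ 2 * derivative ℂ (trunc n S : ℂ⟦X⟧)
      + X ^ n * ((n : ℂ⟦X⟧) * X * T + X ^ 2 * derivative ℂ T) := by
    rw [← e3, ← mul_add, ← map_add, ← hT]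
  have e5 : ABModule.a (S • x) = ABModule.a ((trunc n S : ℂ⟦X⟧) • x)
      + ABModule.a ((X : ℂ⟦X⟧) ^ n • (T • x)) := by
    rw [← map_add, smul_smul, ← add_smul, ← hT]
  have e6 : S • ABModule.a x = (trunc n S : ℂ⟦X⟧) • ABModule.a x
      + (X ^ n * T : ℂ⟦X⟧) • ABModule.a x := by
    rw [← add_smul, ← hT]
  rw [e4, e5, e6, hpoly, key, mod_aux4]

end Leibniz

/-! ### The rank one modules `E_λ` -/

/-- The (a,b)-module `E_λ = ℂ⟦b⟧ e_λ` with `a e_λ = λ b e_λ`; the generator `e_λ` is `1`. -/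
def Elam (_lam : ℂ) : Type := ℂ⟦X⟧

namespace Elam

variable (lam : ℂ)

instance : AddCommGroup (Elam lam) := inferInstanceAs (AddCommGroup ℂ⟦X⟧)
instance : Module ℂ (Elam lam) := inferInstanceAs (Module ℂ ℂ⟦X⟧)
instance : Module ℂ⟦X⟧ (Elam lam) := inferInstanceAs (Module ℂ⟦X⟧ ℂ⟦X⟧)
instance : IsScalarTower ℂ ℂ⟦X⟧ (Elam lam) := inferInstanceAs (IsScalarTower ℂ ℂ⟦X⟧ ℂ⟦X⟧)
instance : Module.Free ℂ⟦X⟧ (Elam lam) := inferInstanceAs (Module.Free ℂ⟦X⟧ ℂ⟦X⟧)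
instance : Module.Finite ℂ⟦X⟧ (Elam lam) := inferInstanceAs (Module.Finite ℂ⟦X⟧ ℂ⟦X⟧)

/-- The operator `a` of `E_λ`: `a (S e_λ) = (λ b S + b² S') e_λ`. -/
def opA : Elam lam →ₗ[ℂ] Elam lam :=
  (lam • LinearMap.mulLeft ℂ (X : ℂ⟦X⟧)
    + (LinearMap.mulLeft ℂ ((X : ℂ⟦X⟧) ^ 2)).comp (derivative ℂ).toLinearMap :
    ℂ⟦X⟧ →ₗ[ℂ] ℂ⟦X⟧)

theorem opA_apply (S : ℂ⟦X⟧) :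
    opA lam S = (lam • (X * S) + X ^ 2 * derivative ℂ S : ℂ⟦X⟧) := rfl

theorem opA_commutation (S : Elam lam) :
    opA lam ((X : ℂ⟦X⟧) • S) - (X : ℂ⟦X⟧) • opA lam S = (X : ℂ⟦X⟧) ^ 2 • S := by
  have aux : ∀ S : ℂ⟦X⟧, lam • (X * (X * S)) + X ^ 2 * derivative ℂ (X * S)
      - X * (lam • (X * S) + X ^ 2 * derivative ℂ S) = X ^ 2 * S := by
    intro S
    rw [Derivation.leibniz, derivative_X, smul_eq_mul, smul_eq_mul, smul_eq_C_mul, smul_eq_C_mul]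
    ring
  exact aux S

instance : ABModule (Elam lam) where
  free := inferInstance
  finite := inferInstance
  a := opA lam
  continuous_a := continuous_of_commutation _ (opA_commutation lam)
  commutation := opA_commutation lam

end Elam

/-! ### Morphisms, `Hom_{a,b}` and the dual -/

section Hom

variable (E F : Type*)
  [AddCommGroup E] [Module ℂ E] [Module ℂ⟦X⟧ E] [IsScalarTower ℂ ℂ⟦X⟧ E] [ABModule E]
  [AddCommGroup F] [Module ℂ F] [Module ℂ⟦X⟧ F] [IsScalarTower ℂ ℂ⟦X⟧ F] [ABModule F]

/-- There is a non zero morphism of (a,b)-modules `E → F`. -/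
def HasNonzeroMorphism : Prop :=
  ∃ φ : E →ₗ[ℂ⟦X⟧] F, (∀ x : E, φ (ABModule.a x) = ABModule.a (φ x)) ∧ φ ≠ 0

/-- `Hom_{a,b}(E, F)`: the `ℂ⟦b⟧`-linear maps `E → F`, on which `S(b)` acts as `S(-b)` and
`a` acts by `(a φ)(e) = φ (a e) - a (φ e)`. -/
def HomAB : Type _ := E →ₗ[ℂ⟦X⟧] F

namespace HomAB

variable {E F}

/-- The underlying `ℂ⟦b⟧`-linear map. -/
def toLin (φ : HomAB E F) : E →ₗ[ℂ⟦X⟧] F := φ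

/-- A `ℂ⟦b⟧`-linear map as an element of `Hom_{a,b}(E, F)`. -/
def ofLin (φ : E →ₗ[ℂ⟦X⟧] F) : HomAB E F := φ

instance : AddCommGroup (HomAB E F) := inferInstanceAs (AddCommGroup (E →ₗ[ℂ⟦X⟧] F))
instance : Module ℂ (HomAB E F) := inferInstanceAs (Module ℂ (E →ₗ[ℂ⟦X⟧] F))
instance : Module ℂ⟦X⟧ (HomAB E F) :=
  Module.compHom (E →ₗ[ℂ⟦X⟧] F) (evalNegHom : ℂ⟦X⟧ →+* ℂ⟦X⟧)

theorem smul_def (S : ℂ⟦X⟧) (φ : HomAB E F) :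
    S • φ = ofLin ((evalNegHom S : ℂ⟦X⟧) • toLin φ) := rfl

theorem evalNeg_evalNeg (S : ℂ⟦X⟧) : evalNegHom (evalNegHom S) = S := by
  ext n
  simp [evalNegHom, coeff_rescale, ← mul_assoc, ← mul_pow]

theorem evalNeg_smul (c : ℂ) (S : ℂ⟦X⟧) : evalNegHom (c • S) = c • evalNegHom S := by
  ext n
  simp [evalNegHom, coeff_rescale]
  ring

instance : IsScalarTower ℂ ℂ⟦X⟧ (HomAB E F) where
  smul_assoc c S φ := by
    rw [smul_def, smul_def, evalNeg_smul]
    exact smul_assoc c (evalNegHom S : ℂ⟦X⟧) (toLin φ)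

/-- The coordinates of `φ` in a basis of `E →ₗ F`, with `b` replaced by `-b`. -/
def coordEquiv {ι : Type*} [Finite ι] (B : Module.Basis ι ℂ⟦X⟧ (E →ₗ[ℂ⟦X⟧] F)) :
    HomAB E F ≃ₗ[ℂ⟦X⟧] (ι → ℂ⟦X⟧) where
  toFun φ i := evalNegHom (B.equivFun (toLin φ) i)
  invFun v := ofLin (B.equivFun.symm fun i => evalNegHom (v i))
  map_add' φ ψ := by
    have : toLin (φ + ψ) = toLin φ + toLin ψ := rfl
    ext1 i
    simp [this]
  map_smul' S φ := by
    have : toLin (S • φ) = (evalNegHom S : ℂ⟦X⟧) • toLin φ := rfl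
    ext1 i
    simp [this, evalNeg_evalNeg]
  left_inv φ := by
    simp only [evalNeg_evalNeg]
    exact B.equivFun.symm_apply_apply (toLin φ)
  right_inv v := by
    ext1 i
    change evalNegHom (B.equivFun (B.equivFun.symm fun i => evalNegHom (v i)) i) = v i
    rw [LinearEquiv.apply_symm_apply, evalNeg_evalNeg]

instance : Module.Free ℂ⟦X⟧ (HomAB E F) :=
  Module.Free.of_equiv
    (coordEquiv (Module.Free.chooseBasis ℂ⟦X⟧ (E →ₗ[ℂ⟦X⟧] F))).symm

instance : Module.Finite ℂ⟦X⟧ (HomAB E F) :=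
  Module.Finite.equiv
    (coordEquiv (Module.Free.chooseBasis ℂ⟦X⟧ (E →ₗ[ℂ⟦X⟧] F))).symm

/-- The operator `Λ`, `Λ(φ)(e) = φ (a e) - a (φ e)`. -/
def opA : HomAB E F →ₗ[ℂ] HomAB E F where
  toFun φ := ofLin
    { toFun := fun e => toLin φ (ABModule.a e) - ABModule.a (toLin φ e)
      map_add' := fun x y => by simp only [map_add]; abel
      map_smul' := fun S x => by
        rw [a_smul, map_add, map_smul, map_smul, map_smul, a_smul, RingHom.id_apply, mod_aux5] }
  map_add' φ ψ := by
    apply LinearMap.ext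
    intro e
    change (toLin φ (ABModule.a e) + toLin ψ (ABModule.a e))
        - ABModule.a (toLin φ e + toLin ψ e)
      = (toLin φ (ABModule.a e) - ABModule.a (toLin φ e))
        + (toLin ψ (ABModule.a e) - ABModule.a (toLin ψ e))
    rw [map_add]; abel
  map_smul' c φ := by
    apply LinearMap.ext
    intro e
    change c • toLin φ (ABModule.a e) - ABModule.a (c • toLin φ e)
      = c • (toLin φ (ABModule.a e) - ABModule.a (toLin φ e))
    rw [map_smul, smul_sub]

theorem opA_apply (φ : HomAB E F) (e : E) :
    toLin (opA φ) e = toLin φ (ABModule.a e) - ABModule.a (toLin φ e) := rfl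

theorem opA_commutation (φ : HomAB E F) :
    opA ((X : ℂ⟦X⟧) • φ) - (X : ℂ⟦X⟧) • opA φ = (X : ℂ⟦X⟧) ^ 2 • φ := by
  apply LinearMap.ext
  intro e
  change ((evalNegHom (X : ℂ⟦X⟧) : ℂ⟦X⟧) • toLin φ (ABModule.a e)
      - ABModule.a ((evalNegHom (X : ℂ⟦X⟧) : ℂ⟦X⟧) • toLin φ e))
    - (evalNegHom (X : ℂ⟦X⟧) : ℂ⟦X⟧) • (toLin φ (ABModule.a e) - ABModule.a (toLin φ e))
    = (evalNegHom ((X : ℂ⟦X⟧) ^ 2) : ℂ⟦X⟧) • toLin φ e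
  rw [a_smul, map_pow, evalNegHom_X, map_neg, derivative_X, mod_aux6]

instance : ABModule (HomAB E F) where
  free := inferInstance
  finite := inferInstance
  a := opA
  continuous_a := continuous_of_commutation _ opA_commutation
  commutation := opA_commutation

end HomAB

/-- The dual `E^* = Hom_{a,b}(E, E_0)`. -/
abbrev Dual : Type _ := HomAB E (Elam 0)

end Hom

/-! ### Simple poles and the spectrum -/

section SimplePole

variable (E : Type*)
  [AddCommGroup E] [Module ℂ E] [Module ℂ⟦X⟧ E] [IsScalarTower ℂ ℂ⟦X⟧ E] [ABModule E]

/-- `a E ⊆ b E`. -/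
def IsSimplePole : Prop := ∀ x : E, ∃ y : E, ABModule.a x = (X : ℂ⟦X⟧) • y

variable {E}

theorem X_smul_injective [Module.Free ℂ⟦X⟧ E] {x y : E}
    (h : (X : ℂ⟦X⟧) • x = (X : ℂ⟦X⟧) • y) : x = y :=
  smul_right_injective E (X_ne_zero (R := ℂ)) h

/-- The map `b⁻¹ a : E → E` of a simple pole (a,b)-module. -/
def bInvA (h : IsSimplePole E) : E →ₗ[ℂ] E where
  toFun x := (h x).choose
  map_add' x y := by
    apply X_smul_injective
    rw [smul_add, ← (h x).choose_spec, ← (h y).choose_spec, ← (h (x + y)).choose_spec, map_add]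
  map_smul' c x := by
    apply X_smul_injective
    rw [RingHom.id_apply, smul_comm, ← (h x).choose_spec, ← (h (c • x)).choose_spec, map_smul]

theorem X_smul_bInvA (h : IsSimplePole E) (x : E) :
    (X : ℂ⟦X⟧) • bInvA h x = ABModule.a x := (h x).choose_spec.symm

variable (E) in
/-- The subspace `b E` of `E`. -/
def bE : Submodule ℂ E := LinearMap.range (Module.toModuleEnd ℂ E (S := ℂ⟦X⟧) X)

theorem mem_bE {x : E} : x ∈ bE E ↔ ∃ y : E, (X : ℂ⟦X⟧) • y = x := Iff.rfl

theorem bE_le_comap (h : IsSimplePole E) : bE E ≤ (bE E).comap (bInvA h) := by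
  intro x hx
  obtain ⟨y, rfl⟩ := mem_bE.1 hx
  refine mem_bE.2 ⟨bInvA h y + y, ?_⟩
  apply X_smul_injective
  have := ABModule.commutation y
  rw [sub_eq_iff_eq_add] at this
  rw [X_smul_bInvA, this, smul_add, X_smul_bInvA, mod_aux7]

/-- The spectrum `S(E)` of the endomorphism of `E / b E` induced by `b⁻¹ a`. -/
def spec (h : IsSimplePole E) : Set ℂ :=
  spectrum ℂ ((bE E).mapQ (bE E) (bInvA h) (bE_le_comap h) : Module.End ℂ (E ⧸ bE E))

end SimplePole

/-! ### Regularity -/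

section Regular

variable (E : Type*)
  [AddCommGroup E] [Module ℂ E] [Module ℂ⟦X⟧ E] [IsScalarTower ℂ ℂ⟦X⟧ E] [ABModule E]

/-- The localization `E[b⁻¹]`. -/
abbrev Loc : Type _ := LocalizedModule (Submonoid.powers (X : ℂ⟦X⟧)) E

variable {E}

/-- The operator `a` on `E[b⁻¹]`, determined by `a (b⁻ⁿ x) = b⁻ⁿ a x - n b⁻ⁿ⁺¹ x`; in terms of
`x / s`, this is `(s a x - b² s' x) / s²`. -/
def aLoc (z : Loc E) : Loc E :=
  z.liftOn (fun p => LocalizedModule.mk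
      ((p.2 : ℂ⟦X⟧) • ABModule.a p.1 - (X ^ 2 * derivative ℂ (p.2 : ℂ⟦X⟧)) • p.1) (p.2 * p.2))
    (by
      rintro ⟨x, s⟩ ⟨y, t⟩ ⟨u, hu⟩
      simp only [Submonoid.smul_def] at hu
      have hu0 : (u : ℂ⟦X⟧) ≠ 0 := by
        obtain ⟨u, n, rfl⟩ := u
        exact pow_ne_zero _ X_ne_zero
      have h0 : (t : ℂ⟦X⟧) • x = (s : ℂ⟦X⟧) • y := smul_right_injective E hu0 hu
      have h1 := congrArg (ABModule.a (E := E)) h0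
      rw [a_smul, a_smul] at h1
      refine LocalizedModule.mk_eq.2 ⟨1, ?_⟩
      simp only [Submonoid.smul_def, one_smul, Submonoid.coe_mul]
      exact mod_aux8 _ _ _ _ _ _ _ _ _ h0 h1)

theorem aLoc_mk (x : E) (s : Submonoid.powers (X : ℂ⟦X⟧)) :
    aLoc (LocalizedModule.mk x s) = LocalizedModule.mk
      ((s : ℂ⟦X⟧) • ABModule.a x - (X ^ 2 * derivative ℂ (s : ℂ⟦X⟧)) • x) (s * s) := by
  unfold aLoc
  rw [LocalizedModule.liftOn_mk]

/-- The operator `b⁻¹ a` on `E[b⁻¹]`. -/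
def bInvALoc (z : Loc E) : Loc E :=
  LocalizedModule.divBy (⟨X, Submonoid.mem_powers X⟩ : Submonoid.powers (X : ℂ⟦X⟧)) (aLoc z)

variable (E) in
/-- The saturation of `E` by `b⁻¹ a` in `E[b⁻¹]`: the smallest `ℂ⟦b⟧`-submodule containing `E`
and stable by `b⁻¹ a`. -/
def saturation : Submodule ℂ⟦X⟧ (Loc E) :=
  sInf {N | LinearMap.range (LocalizedModule.mkLinearMap (Submonoid.powers (X : ℂ⟦X⟧)) E) ≤ N ∧
    ∀ z ∈ N, bInvALoc z ∈ N}

variable (E) in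
/-- `E` is regular: its saturation by `b⁻¹ a` is finitely generated over `ℂ⟦b⟧`. -/
def IsRegular : Prop := (saturation E).FG

end Regular

/-! ### Width -/

/-- A complex number, `-∞` or `+∞`. -/
inductive ExtComplex : Type
  | negInf : ExtComplex
  | fin (z : ℂ) : ExtComplex
  | posInf : ExtComplex

namespace ExtComplex

instance : Neg ExtComplex where
  neg
    | negInf => posInf
    | fin z => fin (-z)
    | posInf => negInf

/-- The real part, an extended real number. -/
def reE : ExtComplex → EReal
  | negInf => ⊥
  | fin z => (z.re : EReal)
  | posInf => ⊤

end ExtComplex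

/-- `ℂ / ℤ`. -/
abbrev CModZ : Type := ℂ ⧸ AddSubgroup.zmultiples (1 : ℂ)

open Classical in
/-- The infimum of a set `S` of complex numbers lying in one class modulo `ℤ`, the class being
ordered by real parts: `+∞` if `S` is empty, the smallest element of `S` if there is one, and
`-∞` otherwise (then `S` is not bounded below). -/
def classInf (S : Set ℂ) : ExtComplex :=
  if S = ∅ then .posInf
  else if h : ∃ m : ℂ, m ∈ S ∧ ∀ z ∈ S, m.re ≤ z.re then .fin h.choose
  else .negInf

open Classical in
/-- The supremum of a set `S` of complex numbers lying in one class modulo `ℤ`, the class being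
ordered by real parts: `-∞` if `S` is empty, the largest element of `S` if there is one, and
`+∞` otherwise (then `S` is not bounded above). -/
def classSup (S : Set ℂ) : ExtComplex :=
  if S = ∅ then .negInf
  else if h : ∃ m : ℂ, m ∈ S ∧ ∀ z ∈ S, z.re ≤ m.re then .fin h.choose
  else .posInf

section Width

variable (E : Type*)
  [AddCommGroup E] [Module ℂ E] [Module ℂ⟦X⟧ E] [IsScalarTower ℂ ℂ⟦X⟧ E] [ABModule E]

/-- `λ̃_min(E)`, for a class `c = λ̃` in `ℂ / ℤ`. -/
def lamMin (c : CModZ) : ExtComplex :=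
  classInf {lam : ℂ | (lam : CModZ) = c ∧ HasNonzeroMorphism (Elam lam) E}

/-- `λ̃_max(E)`, for a class `c = λ̃` in `ℂ / ℤ`. -/
def lamMax (c : CModZ) : ExtComplex :=
  classSup {lam : ℂ | (lam : CModZ) = c ∧ HasNonzeroMorphism E (Elam lam)}

/-- `L_λ̃(E) = λ̃_max(E) - λ̃_min(E)`; both terms lie in the same class modulo `ℤ`, so the
difference is that of the real parts. In `EReal`, `⊥ - x = ⊥` for all `x` and `⊤ - x = ⊤` for
all `x ≠ ⊤`. -/
def widthAt (c : CModZ) : EReal := (lamMax E c).reE - (lamMin E c).reE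

/-- The width `L(E)`, the supremum of the `L_λ̃(E)`. -/
def width : EReal := ⨆ c : CModZ, widthAt E c

end Width

end AB

end

noncomputable section

set_option linter.unusedSectionVars false

namespace AB

open PowerSeries

/-! ### Infima and suprema in a class modulo `ℤ` -/

section ClassOrder

/-! A non zero morphism `E_λ → E` amounts to a non zero `x` with `a x = λ b x`. If `E` has a simple
pole, write `x = b^k y` with `y` not in `bE`; since `b⁻¹a` composed with `b^k` equals `b^k (b⁻¹a +
k)`, the class of `y` is an eigenvector for `λ - k`. Conversely an eigenvector for `λ` lifts to `E`
by successive approximation in powers of `b`, the only obstructions being the `λ - k` with `k > 0`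
in the spectrum. The least spectral value in a class meets none of them, whence the formula for the
minimum (`exists_sub_nat_mem_spec`, `hasNonzeroMorphism_of_mem_spec`).

Duality exchanges morphisms to `E_λ` with morphisms from `E_{-λ}`, by rereading linear forms and by
reflexivity of finite free modules; this gives the symmetry of the invariants. The dual of a simple
pole module has a simple pole and the opposite spectrum, so the formula for the maximum follows from
the one for the minimum.

For regular `E`, a multiple `b^N` of the saturation is a simple pole submodule `F` with `b^N E ⊆ F ⊆
E`. Passing between `E` and `F` moves `λ` by `0` or `±N`, hence keeps its class modulo `ℤ`, and the
finiteness statements descend from the finite set `S(F)`. -/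

theorem eq_of_mk_eq_of_re_eq {z w : ℂ} (h : (z : CModZ) = (w : CModZ)) (hre : z.re = w.re) :
    z = w := by
  obtain ⟨n, hn⟩ := AddSubgroup.mem_zmultiples_iff.1 (QuotientAddGroup.eq.1 h)
  have hn' : (n : ℂ) = -z + w := by simpa using hn
  have hn0 : n = 0 := by
    have := congrArg Complex.re hn'
    simpa [hre] using this
  rw [hn0] at hn'
  linear_combination (by simpa using hn' : (0 : ℂ) = -z + w)

theorem mk_add_int (z : ℂ) (n : ℤ) : ((z + n : ℂ) : CModZ) = (z : CModZ) := by
  symm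
  rw [QuotientAddGroup.eq, AddSubgroup.mem_zmultiples_iff]
  exact ⟨n, by simp⟩

theorem mk_add_nat (z : ℂ) (n : ℕ) : ((z + n : ℂ) : CModZ) = (z : CModZ) := by
  exact_mod_cast mk_add_int z n

theorem mk_sub_nat (z : ℂ) (n : ℕ) : ((z - n : ℂ) : CModZ) = (z : CModZ) := by
  have := mk_add_int z (-n)
  push_cast at this
  rwa [← sub_eq_add_neg] at this

variable {S T : Set ℂ} {c : CModZ}

/-- The choice made in `classInf` is harmless: two minimisers in one class have the same real part,
so they differ by an integer equal to zero. -/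
theorem classInf_eq_fin (hS : ∀ z ∈ S, (z : CModZ) = c) {m : ℂ} (hm : m ∈ S)
    (hmin : ∀ z ∈ S, m.re ≤ z.re) : classInf S = .fin m := by
  have h : ∃ m : ℂ, m ∈ S ∧ ∀ z ∈ S, m.re ≤ z.re := ⟨m, hm, hmin⟩
  unfold classInf
  rw [if_neg (Set.nonempty_iff_ne_empty.1 ⟨m, hm⟩), dif_pos h]
  congr 1
  exact eq_of_mk_eq_of_re_eq ((hS _ h.choose_spec.1).trans (hS _ hm).symm)
    (le_antisymm (h.choose_spec.2 m hm) (hmin _ h.choose_spec.1))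

theorem classSup_eq_fin (hS : ∀ z ∈ S, (z : CModZ) = c) {m : ℂ} (hm : m ∈ S)
    (hmax : ∀ z ∈ S, z.re ≤ m.re) : classSup S = .fin m := by
  have h : ∃ m : ℂ, m ∈ S ∧ ∀ z ∈ S, z.re ≤ m.re := ⟨m, hm, hmax⟩
  unfold classSup
  rw [if_neg (Set.nonempty_iff_ne_empty.1 ⟨m, hm⟩), dif_pos h]
  congr 1
  exact eq_of_mk_eq_of_re_eq ((hS _ h.choose_spec.1).trans (hS _ hm).symm)
    (le_antisymm (hmax _ h.choose_spec.1) (h.choose_spec.2 m hm))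

theorem classInf_eq_posInf_iff : classInf S = .posInf ↔ S = ∅ := by
  unfold classInf
  split_ifs with h1 h2 <;> simp [h1]

theorem classSup_eq_negInf_iff : classSup S = .negInf ↔ S = ∅ := by
  unfold classSup
  split_ifs with h1 h2 <;> simp [h1]

/-- A set bounded below in a class modulo `ℤ` has a least element, or is empty. -/
theorem exists_min_of_bddBelow (hS : ∀ z ∈ S, (z : CModZ) = c) (hne : S.Nonempty)
    {r : ℝ} (hr : ∀ z ∈ S, r ≤ z.re) : ∃ m ∈ S, ∀ z ∈ S, m.re ≤ z.re := by
  obtain ⟨z₀, hz₀⟩ := hne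
  obtain ⟨n, hn, hmin⟩ := Int.exists_least_of_bdd (P := fun n : ℤ => z₀ + n ∈ S)
    ⟨⌊r - z₀.re⌋, fun n hn => by
      have := hr _ hn
      simp only [Complex.add_re, Complex.intCast_re] at this
      have h2 : ((⌊r - z₀.re⌋ : ℤ) : ℝ) ≤ n := (Int.floor_le _).trans (by linarith)
      exact_mod_cast h2⟩ ⟨0, by simpa using hz₀⟩
  refine ⟨_, hn, fun z hz => ?_⟩
  obtain ⟨k, hk⟩ := AddSubgroup.mem_zmultiples_iff.1
    (QuotientAddGroup.eq.1 ((hS _ hz₀).trans (hS _ hz).symm))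
  have hk' : z = z₀ + k := by
    have : (k : ℂ) = -z₀ + z := by simpa using hk
    rw [this]; ring
  have := hmin k (hk' ▸ hz)
  rw [hk']
  simpa using this

theorem classInf_ne_negInf (hS : ∀ z ∈ S, (z : CModZ) = c)
    {r : ℝ} (hr : ∀ z ∈ S, r ≤ z.re) : classInf S ≠ .negInf := by
  rcases S.eq_empty_or_nonempty with h | h
  · rw [classInf_eq_posInf_iff.2 h]; simp
  · obtain ⟨m, hm, hmin⟩ := exists_min_of_bddBelow hS h hr
    rw [classInf_eq_fin hS hm hmin]; simp

theorem classSup_neg (hS : ∀ z ∈ S, (z : CModZ) = c) :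
    classSup {z | -z ∈ S} = -classInf S := by
  by_cases h0 : S = ∅
  · rw [classInf_eq_posInf_iff.2 h0, classSup_eq_negInf_iff.2 (by simp [h0])]; rfl
  by_cases h : ∃ m : ℂ, m ∈ S ∧ ∀ z ∈ S, m.re ≤ z.re
  · obtain ⟨m, hm, hmin⟩ := h
    rw [classInf_eq_fin hS hm hmin,
      classSup_eq_fin (c := -c) (m := -m) _ (by simpa using hm)]
    · rfl
    · intro z hz
      have := hmin _ hz
      simp only [Complex.neg_re] at this ⊢
      linarith
    · intro z hz
      rw [← hS _ hz]
      simp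
  · have h0' : {z : ℂ | -z ∈ S} ≠ ∅ := by
      obtain ⟨z, hz⟩ := Set.nonempty_iff_ne_empty.2 h0
      exact Set.nonempty_iff_ne_empty.1 ⟨-z, by simpa using hz⟩
    have h' : ¬∃ m : ℂ, m ∈ {z : ℂ | -z ∈ S} ∧ ∀ z ∈ {z : ℂ | -z ∈ S}, z.re ≤ m.re := by
      rintro ⟨m, hm, hmax⟩
      refine h ⟨-m, hm, fun z hz => ?_⟩
      have := hmax (-z) (by simpa using hz)
      simp only [Complex.neg_re] at this ⊢
      linarith
    unfold classSup classInf
    rw [if_neg h0', dif_neg h', if_neg h0, dif_neg h]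
    rfl

theorem ExtComplex.neg_neg (x : ExtComplex) : - -x = x := by
  rcases x with _ | z | _
  · rfl
  · exact congrArg ExtComplex.fin (_root_.neg_neg z)
  · rfl

theorem ExtComplex.reE_neg (x : ExtComplex) : (-x).reE = -x.reE := by
  rcases x with _ | z | _
  · exact EReal.neg_bot.symm
  · change (((-z).re : ℝ) : EReal) = -((z.re : ℝ) : EReal)
    simp
  · exact EReal.neg_top.symm

theorem classInf_neg (hS : ∀ z ∈ S, (z : CModZ) = c) :
    classInf {z | -z ∈ S} = -classSup S := by
  have := classSup_neg (S := {z | -z ∈ S}) (c := -c) fun z hz => by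
    rw [← hS _ hz]
    simp
  simp only [Set.mem_ofPred_eq, neg_neg, Set.ofPred_mem_eq] at this
  rw [this, ExtComplex.neg_neg]

/-- A set `S` in a class has the same infimum as a finite set `T` which bounds it from below and
whose least element belongs to `S`. -/
theorem classInf_congr (hS : ∀ z ∈ S, (z : CModZ) = c) (hT : ∀ z ∈ T, (z : CModZ) = c)
    (hTf : T.Finite) (h1 : ∀ z ∈ S, ∃ w ∈ T, w.re ≤ z.re)
    (h2 : ∀ w ∈ T, (∀ w' ∈ T, w.re ≤ w'.re) → w ∈ S) : classInf S = classInf T := by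
  rcases T.eq_empty_or_nonempty with h | h
  · rw [classInf_eq_posInf_iff.2 h, classInf_eq_posInf_iff, Set.eq_empty_iff_forall_notMem]
    intro z hz
    obtain ⟨w, hw, -⟩ := h1 z hz
    simp [h] at hw
  · obtain ⟨m, hm, hmin⟩ := hTf.exists_minimalFor Complex.re T h
    have hmin' : ∀ w ∈ T, m.re ≤ w.re := fun w hw =>
      (le_total m.re w.re).elim id fun h => hmin hw h
    rw [classInf_eq_fin hT hm hmin', classInf_eq_fin hS (h2 m hm hmin')]
    intro z hz
    obtain ⟨w, hw, hwz⟩ := h1 z hz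
    exact (hmin' w hw).trans hwz

end ClassOrder

/-! ### Morphisms from and to `E_λ`, and duality -/

section Duality

variable {E : Type*}
  [AddCommGroup E] [Module ℂ E] [Module ℂ⟦X⟧ E] [IsScalarTower ℂ ℂ⟦X⟧ E] [ABModule E]

/-- A non zero morphism `E_λ → E` is a non zero `x : E` with `a x = λ b x`. -/
theorem hasNonzeroMorphism_Elam_left_iff {lam : ℂ} :
    HasNonzeroMorphism (Elam lam) E ↔
      ∃ x : E, x ≠ 0 ∧ ABModule.a x = lam • (X : ℂ⟦X⟧) • x := by
  constructor
  · rintro ⟨φ, hφ, h0⟩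
    let e : Elam lam := (1 : ℂ⟦X⟧)
    have hS : ∀ S : Elam lam, ∃ T : ℂ⟦X⟧, S = T • e := fun S => ⟨S, (mul_one (M := ℂ⟦X⟧) S).symm⟩
    refine ⟨φ e, fun h => h0 ?_, ?_⟩
    · refine LinearMap.ext fun S => ?_
      obtain ⟨T, rfl⟩ := hS S
      rw [map_smul, h, smul_zero, LinearMap.zero_apply]
    · rw [← hφ]
      have : (ABModule.a e : Elam lam) = (lam • (X : ℂ⟦X⟧)) • e := by
        change (lam • (X * 1) + X ^ 2 * derivative ℂ (1 : ℂ⟦X⟧) : ℂ⟦X⟧) = (lam • X) * 1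
        simp
      rw [this, map_smul, smul_assoc]
  · rintro ⟨x, hx, hax⟩
    let φ : Elam lam →ₗ[ℂ⟦X⟧] E := LinearMap.toSpanSingleton ℂ⟦X⟧ E x
    have hφ : ∀ S : ℂ⟦X⟧, φ S = S • x := fun S => rfl
    have hφa : ∀ S : ℂ⟦X⟧, φ (lam • (X * S) + X ^ 2 * derivative ℂ S : ℂ⟦X⟧)
        = ABModule.a (φ S) := by
      intro S
      rw [hφ, hφ, a_smul, hax, add_smul, smul_assoc, mul_comm X, mul_smul, smul_comm lam S]
    refine ⟨φ, hφa, fun h => hx ?_⟩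
    rw [← one_smul ℂ⟦X⟧ x, ← hφ, h]
    rfl

theorem hasNonzeroMorphism_Elam_right_iff {lam : ℂ} :
    HasNonzeroMorphism E (Elam lam) ↔
      ∃ φ : E →ₗ[ℂ⟦X⟧] ℂ⟦X⟧, φ ≠ 0 ∧
        ∀ x, φ (ABModule.a x) = lam • (X * φ x) + X ^ 2 * derivative ℂ (φ x) :=
  ⟨fun ⟨φ, h, h0⟩ => ⟨φ, h0, h⟩, fun ⟨φ, h0, h⟩ => ⟨φ, h, h0⟩⟩

theorem derivative_evalNegHom (f : ℂ⟦X⟧) :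
    derivative ℂ (evalNegHom f) = -evalNegHom (derivative ℂ f) := by
  ext n
  simp [evalNegHom, coeff_rescale, coeff_derivative, pow_succ]
  ring

/-- The dual as an additive group, identified with the `ℂ⟦b⟧`-linear forms on `E`. -/
def dualEquiv : Dual E ≃+ (E →ₗ[ℂ⟦X⟧] ℂ⟦X⟧) := AddEquiv.refl _

theorem dualEquiv_smul (S : ℂ⟦X⟧) (φ : Dual E) :
    dualEquiv (S • φ) = (evalNegHom S : ℂ⟦X⟧) • dualEquiv φ := rfl

theorem dualEquiv_smul_complex (z : ℂ) (φ : Dual E) :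
    dualEquiv (z • φ) = z • dualEquiv φ := rfl

theorem dualEquiv_a (φ : Dual E) (x : E) :
    dualEquiv (ABModule.a φ) x
      = dualEquiv φ (ABModule.a x) - X ^ 2 * derivative ℂ (dualEquiv φ x) := by
  change dualEquiv φ (ABModule.a x) - ((0 : ℂ) • (X * dualEquiv φ x)
    + X ^ 2 * derivative ℂ (dualEquiv φ x)) = _
  rw [zero_smul, zero_add]

/-- In the dual, the morphism equation for a form `φ` reads `a φ = -λ b φ`: the `b² φ'` term is
absorbed by the operator `a` of `E_0`, and the sign comes from `b` acting as `-b`. -/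
theorem hasNonzeroMorphism_Elam_right_iff_dual {lam : ℂ} :
    HasNonzeroMorphism E (Elam lam) ↔ HasNonzeroMorphism (Elam (-lam)) (Dual E) := by
  rw [hasNonzeroMorphism_Elam_right_iff, hasNonzeroMorphism_Elam_left_iff,
    ← dualEquiv.exists_congr_right]
  refine exists_congr fun φ => and_congr (by simp) ?_
  rw [← dualEquiv.injective.eq_iff, LinearMap.ext_iff]
  refine forall_congr' fun x => ?_
  rw [dualEquiv_a, dualEquiv_smul_complex, dualEquiv_smul, evalNegHom_X, sub_eq_iff_eq_add]
  simp

theorem hasNonzeroMorphism_Elam_left_iff_dual {lam : ℂ} :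
    HasNonzeroMorphism (Elam lam) E ↔ HasNonzeroMorphism (Dual E) (Elam (-lam)) := by
  rw [hasNonzeroMorphism_Elam_right_iff, hasNonzeroMorphism_Elam_left_iff]
  constructor
  · rintro ⟨x, hx, hax⟩
    -- Evaluation at `x` is only semilinear on the dual; substituting `-b` for `b` in its value
    -- makes it linear.
    refine ⟨{ toFun := fun φ => evalNegHom (dualEquiv φ x)
              map_add' := fun φ ψ => by simp
              map_smul' := fun S φ => by
                simp [dualEquiv_smul, HomAB.evalNeg_evalNeg] }, fun h => hx ?_, fun φ => ?_⟩
    · rw [← Module.forall_dual_apply_eq_zero_iff ℂ⟦X⟧]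
      intro φ
      have := LinearMap.congr_fun h (dualEquiv.symm φ)
      rw [← HomAB.evalNeg_evalNeg (φ x)]
      change evalNegHom (φ x) = 0 at this
      rw [this, map_zero]
    · change evalNegHom (dualEquiv (ABModule.a φ) x) = -lam • (X * evalNegHom (dualEquiv φ x))
        + X ^ 2 * derivative ℂ (evalNegHom (dualEquiv φ x))
      rw [dualEquiv_a, hax, derivative_evalNegHom, ← smul_assoc, map_smul, map_sub, smul_eq_mul,
        map_mul, map_mul, map_pow, evalNegHom_X, HomAB.evalNeg_smul, evalNegHom_X]
      simp only [smul_eq_C_mul, map_neg]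
      ring
  · rintro ⟨Φ, hΦ, hΦa⟩
    -- Undoing the twist turns `Φ` into an element of the ordinary bidual, which is evaluation at
    -- some `x` by reflexivity.
    let Ψ : Module.Dual ℂ⟦X⟧ (Module.Dual ℂ⟦X⟧ E) :=
      { toFun := fun φ => evalNegHom (Φ (dualEquiv.symm φ))
        map_add' := fun φ ψ => by simp
        map_smul' := fun S φ => by
          have : dualEquiv.symm (S • φ) = (evalNegHom S : ℂ⟦X⟧) • dualEquiv.symm φ := by
            apply dualEquiv.injective
            simp [dualEquiv_smul, HomAB.evalNeg_evalNeg]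
          simp [this, HomAB.evalNeg_evalNeg] }
    let x : E := (Module.evalEquiv ℂ⟦X⟧ E).symm Ψ
    have hx : ∀ φ : Dual E, dualEquiv φ x = evalNegHom (Φ φ) := fun φ =>
      Module.apply_evalEquiv_symm_apply ℂ⟦X⟧ E (dualEquiv φ) Ψ
    refine ⟨x, fun h => hΦ ?_, ?_⟩
    · ext1 φ
      have := hx φ
      rw [h, map_zero] at this
      rw [← HomAB.evalNeg_evalNeg (Φ φ), ← this, map_zero, LinearMap.zero_apply]
    · rw [← sub_eq_zero, ← Module.forall_dual_apply_eq_zero_iff ℂ⟦X⟧]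
      intro φ
      obtain ⟨φ, rfl⟩ := dualEquiv.surjective φ
      have h1 := dualEquiv_a φ x
      rw [hx, hx, hΦa, derivative_evalNegHom, map_add, HomAB.evalNeg_smul, map_mul, map_mul,
        map_pow, evalNegHom_X] at h1
      rw [map_sub, ← smul_assoc, map_smul, hx, smul_eq_mul]
      simp only [smul_eq_C_mul, map_neg] at h1 ⊢
      linear_combination -h1

theorem lamMax_dual (c : CModZ) : lamMax (Dual E) (-c) = -lamMin E c := by
  rw [lamMin, ← classSup_neg (c := c) fun z hz => hz.1, lamMax]
  congr 1
  ext z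
  simp only [Set.mem_ofPred_eq]
  rw [hasNonzeroMorphism_Elam_left_iff_dual, neg_neg, QuotientAddGroup.mk_neg, neg_eq_iff_eq_neg]

theorem lamMin_dual (c : CModZ) : lamMin (Dual E) (-c) = -lamMax E c := by
  rw [lamMax, ← classInf_neg (c := c) fun z hz => hz.1, lamMin]
  congr 1
  ext z
  simp only [Set.mem_ofPred_eq]
  rw [hasNonzeroMorphism_Elam_right_iff_dual, neg_neg, QuotientAddGroup.mk_neg,
    neg_eq_iff_eq_neg]

theorem widthAt_dual (c : CModZ) : widthAt (Dual E) (-c) = widthAt E c := by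
  rw [widthAt, widthAt, lamMax_dual, lamMin_dual, ExtComplex.reE_neg, ExtComplex.reE_neg,
    sub_eq_add_neg, neg_neg, sub_eq_add_neg, add_comm]

theorem width_dual : width (Dual E) = width E := by
  rw [width, width, ← (Equiv.neg CModZ).iSup_comp]
  exact iSup_congr fun c => widthAt_dual c

end Duality

/-! ### Simple pole (a,b)-modules -/

section Adic

variable {E : Type*} [AddCommGroup E] [Module ℂ⟦X⟧ E] [Module.Free ℂ⟦X⟧ E] [Module.Finite ℂ⟦X⟧ E]

/-- A finite free `ℂ⟦b⟧`-module is complete for the `b`-adic topology. -/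
theorem exists_adic_limit (u : ℕ → E) (hu : ∀ n, ∃ y, u (n + 1) - u n = (X : ℂ⟦X⟧) ^ n • y) :
    ∃ x : E, ∀ n, ∃ y, x - u n = (X : ℂ⟦X⟧) ^ n • y := by
  let B := Module.Free.chooseBasis ℂ⟦X⟧ E
  -- From `u (n + 1)` on, the coefficient of degree `n` no longer changes.
  let s : Module.Free.ChooseBasisIndex ℂ⟦X⟧ E → ℂ⟦X⟧ := fun i =>
    PowerSeries.mk fun n => coeff n (B.repr (u (n + 1)) i)
  have hstep : ∀ i n k, k < n → coeff k (B.repr (u (n + 1)) i) = coeff k (B.repr (u n) i) := by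
    intro i n k hk
    obtain ⟨y, hy⟩ := hu n
    rw [sub_eq_iff_eq_add] at hy
    rw [hy]
    simp [coeff_X_pow_mul', hk.not_ge]
  have hstab : ∀ i k n, k < n → coeff k (B.repr (u n) i) = coeff k (B.repr (u (k + 1)) i) := by
    intro i k n hk
    induction n, hk using Nat.le_induction with
    | base => rfl
    | succ n hn ih => rw [hstep i n k hn, ih]
  refine ⟨B.equivFun.symm s, fun n => ?_⟩
  have : ∀ i, ∃ t : ℂ⟦X⟧, s i - B.repr (u n) i = X ^ n * t := by
    intro i
    have : (X : ℂ⟦X⟧) ^ n ∣ s i - B.repr (u n) i := by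
      rw [X_pow_dvd_iff]
      intro k hk
      rw [map_sub, hstab i k n hk]
      simp [s]
    exact this
  choose t ht using this
  refine ⟨B.equivFun.symm t, B.equivFun.injective ?_⟩
  rw [map_sub, map_smul, LinearEquiv.apply_symm_apply, LinearEquiv.apply_symm_apply]
  ext1 i
  exact ht i

end Adic

section SimplePole

variable {E : Type*}
  [AddCommGroup E] [Module ℂ E] [Module ℂ⟦X⟧ E] [IsScalarTower ℂ ℂ⟦X⟧ E] [ABModule E]

/-- A non zero element is `b ^ k y` with `y ∉ b E`. -/
theorem exists_eq_X_pow_smul {x : E} (hx : x ≠ 0) :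
    ∃ (k : ℕ) (y : E), x = (X : ℂ⟦X⟧) ^ k • y ∧ y ∉ bE E := by
  classical
  have h : ∃ n, ¬∃ y : E, x = (X : ℂ⟦X⟧) ^ n • y := by
    by_contra! h
    exact hx (eq_zero_of_forall_X_pow x h)
  have h0 : Nat.find h ≠ 0 := fun h0 => by
    have := Nat.find_spec h
    rw [h0] at this
    exact this ⟨x, by simp⟩
  obtain ⟨k, hk⟩ := Nat.exists_eq_succ_of_ne_zero h0
  -- `k + 1` is the first exponent whose power of `b` does not divide `x`.
  obtain ⟨y, hy⟩ := not_not.1 (Nat.find_min h (m := k) (by omega))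
  refine ⟨k, y, hy, fun hyb => ?_⟩
  obtain ⟨z, rfl⟩ := mem_bE.1 hyb
  refine Nat.find_spec h ⟨z, ?_⟩
  rw [hk, hy, smul_smul, pow_succ]

theorem C_smul (z : ℂ) (x : E) : (C z : ℂ⟦X⟧) • x = z • x := by
  rw [← mul_one (C z), ← smul_eq_C_mul, smul_assoc, one_smul]

theorem X_smul_mem_bE (x : E) : (X : ℂ⟦X⟧) • x ∈ bE E := mem_bE.2 ⟨x, rfl⟩

theorem smul_sub_constantCoeff_smul_mem_bE (S : ℂ⟦X⟧) (x : E) :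
    S • x - constantCoeff S • x ∈ bE E := by
  obtain ⟨T, hT⟩ := X_dvd_iff.2 (by simp : constantCoeff (S - C (constantCoeff S)) = 0)
  have : S • x - constantCoeff S • x = (X : ℂ⟦X⟧) • T • x := by
    rw [smul_smul, ← hT, sub_smul, C_smul]
  rw [this]
  exact X_smul_mem_bE _

instance : FiniteDimensional ℂ (E ⧸ bE E) := by
  classical
  obtain ⟨s, hs⟩ := (inferInstance : Module.Finite ℂ⟦X⟧ E).fg_top
  refine ⟨s.image (bE E).mkQ, ?_⟩
  rw [eq_top_iff]
  rintro v -
  obtain ⟨x, rfl⟩ := (bE E).mkQ_surjective v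
  have hx : x ∈ Submodule.span ℂ⟦X⟧ (s : Set E) := hs ▸ Submodule.mem_top
  induction hx using Submodule.span_induction with
  | mem x hx => exact Submodule.subset_span (by simpa using ⟨x, hx, rfl⟩)
  | zero => simp
  | add x y _ _ hx hy => rw [map_add]; exact add_mem hx hy
  | smul S x _ hx =>
    have : (bE E).mkQ (S • x) = constantCoeff S • (bE E).mkQ x := by
      rw [← map_smul, ← sub_eq_zero, ← map_sub, Submodule.mkQ_apply,
        Submodule.Quotient.mk_eq_zero]
      exact smul_sub_constantCoeff_smul_mem_bE S x
    rw [this]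
    exact Submodule.smul_mem _ _ hx

variable (h : IsSimplePole E)

theorem spec_finite : (spec h).Finite := Module.End.finite_spectrum _

theorem mem_spec_iff {μ : ℂ} :
    μ ∈ spec h ↔ ∃ x : E, x ∉ bE E ∧ bInvA h x - μ • x ∈ bE E := by
  rw [spec, ← Module.End.hasEigenvalue_iff_mem_spectrum]
  constructor
  · intro hμ
    obtain ⟨v, hv⟩ := hμ.exists_hasEigenvector
    obtain ⟨x, rfl⟩ := (bE E).mkQ_surjective v
    refine ⟨x, fun hx => hv.2 ?_, ?_⟩
    · simpa using hx
    · have := hv.apply_eq_smul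
      rwa [Submodule.mkQ_apply, Submodule.mapQ_apply, ← Submodule.Quotient.mk_smul,
        Submodule.Quotient.eq] at this
  · rintro ⟨x, hx, hμ⟩
    refine Module.End.hasEigenvalue_of_hasEigenvector (x := (bE E).mkQ x)
      ⟨Module.End.mem_eigenspace_iff.2 ?_, by simpa using hx⟩
    rwa [Submodule.mkQ_apply, Submodule.mapQ_apply, ← Submodule.Quotient.mk_smul,
      Submodule.Quotient.eq]

/-- Off the spectrum `b⁻¹a - μ` is onto modulo `b`. This solves for the correction term at each
order of the lifting. -/
theorem exists_of_notMem_spec {μ : ℂ} (hμ : μ ∉ spec h) (w : E) :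
    ∃ y : E, bInvA h y - μ • y - w ∈ bE E := by
  rw [spec, spectrum.notMem_iff, Module.End.isUnit_iff] at hμ
  obtain ⟨v, hv⟩ := hμ.2 (-(bE E).mkQ w)
  obtain ⟨y, rfl⟩ := (bE E).mkQ_surjective v
  refine ⟨y, ?_⟩
  rw [LinearMap.sub_apply, Module.algebraMap_end_apply, Submodule.mkQ_apply, Submodule.mapQ_apply,
    ← neg_eq_iff_eq_neg, neg_sub, ← Submodule.Quotient.mk_smul, ← Submodule.Quotient.mk_sub,
    Submodule.mkQ_apply, Submodule.Quotient.eq] at hv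
  exact hv

/-- For `μ` in the spectrum, the cokernel of `b⁻¹ a - μ` on `E / b E` has a non zero form. -/
theorem exists_form_of_mem_spec {μ : ℂ} (hμ : μ ∈ spec h) :
    ∃ f : E →ₗ[ℂ] ℂ, f ≠ 0 ∧ (∀ x ∈ bE E, f x = 0) ∧ ∀ x, f (bInvA h x) = μ * f x := by
  set T : Module.End ℂ (E ⧸ bE E) := (bE E).mapQ (bE E) (bInvA h) (bE_le_comap h) with hT
  -- In finite dimension a surjective `μ - T` would be invertible; its range is therefore proper and
  -- lies in the kernel of a non zero form.
  have hlt : LinearMap.range (algebraMap ℂ (Module.End ℂ (E ⧸ bE E)) μ - T) < ⊤ := by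
    rw [lt_top_iff_ne_top, Ne, LinearMap.range_eq_top]
    intro hs
    refine hμ ((Module.End.isUnit_iff _).2 ⟨LinearMap.injective_iff_surjective.2 hs, hs⟩)
  obtain ⟨f, hf, hle⟩ := Submodule.exists_le_ker_of_lt_top _ hlt
  refine ⟨f ∘ₗ (bE E).mkQ, fun h0 => hf ?_, fun x hx => ?_, fun x => ?_⟩
  · refine LinearMap.ext fun v => ?_
    obtain ⟨x, rfl⟩ := (bE E).mkQ_surjective v
    exact LinearMap.congr_fun h0 x
  · rw [LinearMap.comp_apply, Submodule.mkQ_apply, (Submodule.Quotient.mk_eq_zero _).2 hx,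
      map_zero]
  · have := hle (LinearMap.mem_range_self _ ((bE E).mkQ x))
    rw [LinearMap.mem_ker, LinearMap.sub_apply, map_sub, Module.algebraMap_end_apply, map_smul,
      sub_eq_zero] at this
    exact this.symm

/-- This shift by `n` is the source of all the integer translations of `λ`, and of the resonances.
-/
theorem bInvA_X_pow_smul (n : ℕ) (x : E) :
    bInvA h ((X : ℂ⟦X⟧) ^ n • x) = (X : ℂ⟦X⟧) ^ n • (bInvA h x + (n : ℂ) • x) := by
  apply X_smul_injective
  rw [X_smul_bInvA, map_X_pow_smul _ ABModule.commutation, ← X_smul_bInvA h, smul_smul, smul_smul,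
    smul_add, ← pow_succ, ← pow_succ', Nat.cast_smul_eq_nsmul, ← nsmul_eq_mul, smul_assoc,
    smul_comm _ n]

theorem exists_sub_nat_mem_spec {lam : ℂ} (hlam : HasNonzeroMorphism (Elam lam) E) :
    ∃ k : ℕ, lam - k ∈ spec h := by
  obtain ⟨x, hx, hax⟩ := hasNonzeroMorphism_Elam_left_iff.1 hlam
  obtain ⟨k, y, rfl, hy⟩ := exists_eq_X_pow_smul hx
  refine ⟨k, (mem_spec_iff h).2 ⟨y, hy, ?_⟩⟩
  rw [← X_smul_bInvA h, smul_comm lam] at hax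
  have := X_smul_injective hax
  rw [bInvA_X_pow_smul, smul_comm lam] at this
  have := smul_right_injective E (pow_ne_zero k (X_ne_zero (R := ℂ))) this
  have h0 : bInvA h y - (lam - k) • y = 0 := by
    rw [sub_smul, ← this]; abel
  rw [h0]
  exact zero_mem _

/-- An eigenvector of `b⁻¹ a` on `E / b E` lifts to `E` in the absence of resonances. -/
theorem hasNonzeroMorphism_of_mem_spec {lam : ℂ} (hlam : lam ∈ spec h)
    (hk : ∀ k : ℕ, 0 < k → lam - k ∉ spec h) : HasNonzeroMorphism (Elam lam) E := by
  rw [hasNonzeroMorphism_Elam_left_iff]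
  obtain ⟨x₀, hx₀, hx₀'⟩ := (mem_spec_iff h).1 hlam
  -- `P n x` says that `x` solves the eigenvector equation modulo `b^(n+1)`.
  let P : ℕ → E → Prop := fun n x => ∃ w, bInvA h x - lam • x = (X : ℂ⟦X⟧) ^ (n + 1) • w
  have hstep : ∀ n x, P n x → ∃ x', P (n + 1) x' ∧ ∃ y, x' - x = (X : ℂ⟦X⟧) ^ (n + 1) • y := by
    rintro n x ⟨w, hw⟩
    -- Adding `b^(n+1) y` changes the error by `b^(n+1) (b⁻¹a - (λ - (n+1))) y`, so the error term
    -- `w` can be cancelled modulo `b`.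
    obtain ⟨y, hy⟩ := exists_of_notMem_spec h (hk (n + 1) n.succ_pos) (-w)
    obtain ⟨z, hz⟩ := mem_bE.1 hy
    refine ⟨x + (X : ℂ⟦X⟧) ^ (n + 1) • y, ⟨z, ?_⟩, y, by abel⟩
    rw [pow_succ _ (n + 1), mul_smul, hz, map_add, bInvA_X_pow_smul, smul_add lam,
      smul_comm lam, add_sub_add_comm, hw, ← smul_sub, ← smul_add]
    congr 1
    rw [sub_smul]
    abel
  choose! g hg hg' using hstep
  let u : ℕ → E := fun n => Nat.rec x₀ (fun n x => g n x) n
  have hu : ∀ n, P n (u n) := by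
    intro n
    induction n with
    | zero =>
      obtain ⟨w, hw⟩ := mem_bE.1 hx₀'
      exact ⟨w, by simpa [u] using hw.symm⟩
    | succ n ih => exact hg n _ ih
  have hu' : ∀ n, ∃ y, u (n + 1) - u n = (X : ℂ⟦X⟧) ^ (n + 1) • y := fun n => hg' n _ (hu n)
  obtain ⟨x, hx⟩ := exists_adic_limit u fun n => by
    obtain ⟨y, hy⟩ := hu' n
    exact ⟨(X : ℂ⟦X⟧) • y, by rw [hy, smul_smul, pow_succ]⟩
  refine ⟨x, ?_, ?_⟩
  -- The limit is congruent to `x₀` modulo `b`, hence is not zero.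
  · rintro rfl
    obtain ⟨y, hy⟩ := hx 1
    obtain ⟨y', hy'⟩ := hu' 0
    apply hx₀
    have : x₀ = (X : ℂ⟦X⟧) • (-y' - y) := by
      rw [smul_sub, smul_neg, ← pow_one (X : ℂ⟦X⟧), ← hy, ← zero_add 1, ← hy']
      change x₀ = _ - (0 - u (0 + 1))
      change u 0 = _
      abel
    rw [this]
    exact X_smul_mem_bE _
  · have h0 : bInvA h x - lam • x = 0 := by
      apply eq_zero_of_forall_X_pow
      intro n
      obtain ⟨y, hy⟩ := hx n
      obtain ⟨w, hw⟩ := hu n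
      rw [sub_eq_iff_eq_add] at hy
      refine ⟨bInvA h y + (n : ℂ) • y - lam • y + (X : ℂ⟦X⟧) • w, ?_⟩
      rw [hy, map_add, bInvA_X_pow_smul, smul_add lam, add_sub_add_comm, hw, smul_comm lam,
        ← smul_sub, pow_succ, mul_smul, ← smul_add]
    rw [← X_smul_bInvA h, sub_eq_zero.1 h0, smul_comm]

/-- The least spectral value of the class has no resonance below it, so it is attained by a
morphism; every other admissible `λ` lies above a spectral value. -/
theorem lamMin_eq_classInf_spec (c : CModZ) :
    lamMin E c = classInf {lam : ℂ | lam ∈ spec h ∧ (lam : CModZ) = c} := by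
  refine classInf_congr (c := c) (fun z hz => hz.1) (fun z hz => hz.2)
    ((spec_finite h).subset fun z hz => hz.1) ?_ ?_
  · rintro z ⟨hz, hm⟩
    obtain ⟨k, hk⟩ := exists_sub_nat_mem_spec h hm
    exact ⟨z - k, ⟨hk, (mk_sub_nat z k).trans hz⟩, by simp⟩
  · rintro w ⟨hw, hc⟩ hmin
    refine ⟨hc, hasNonzeroMorphism_of_mem_spec h hw fun k hk hs => ?_⟩
    have := hmin (w - k) ⟨hs, (mk_sub_nat w k).trans hc⟩
    simp only [Complex.sub_re, Complex.natCast_re] at this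
    have : (0 : ℝ) < k := by exact_mod_cast hk
    linarith

/-! ### The dual of a simple pole module -/

theorem mem_bE_dual_iff {φ : Dual E} :
    φ ∈ bE (Dual E) ↔ ∀ x, constantCoeff (dualEquiv φ x) = 0 := by
  rw [mem_bE]
  constructor
  · rintro ⟨ψ, rfl⟩ x
    rw [dualEquiv_smul, evalNegHom_X]
    simp
  · intro hφ
    let B := Module.Free.chooseBasis ℂ⟦X⟧ E
    choose t ht using fun x => X_dvd_iff.2 (hφ x)
    -- The minus sign compensates for `b` acting as `-b` on the dual.
    refine ⟨dualEquiv.symm (B.constr ℂ⟦X⟧ fun i => -t (B i)), dualEquiv.injective ?_⟩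
    refine B.ext fun i => ?_
    rw [dualEquiv_smul, evalNegHom_X, AddEquiv.apply_symm_apply, LinearMap.smul_apply,
      Module.Basis.constr_basis, ht]
    simp

theorem dualEquiv_a_eq_neg_X_mul (φ : Dual E) (x : E) : dualEquiv (ABModule.a φ) x
    = -X * (X * derivative ℂ (dualEquiv φ x) - dualEquiv φ (bInvA h x)) := by
  rw [dualEquiv_a, ← X_smul_bInvA h, map_smul, smul_eq_mul]
  ring

theorem IsSimplePole.dual (h : IsSimplePole E) : IsSimplePole (Dual E) := by
  intro φ
  have : ABModule.a φ ∈ bE (Dual E) := by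
    rw [mem_bE_dual_iff]
    intro x
    rw [dualEquiv_a_eq_neg_X_mul h]
    simp
  obtain ⟨ψ, hψ⟩ := mem_bE.1 this
  exact ⟨ψ, hψ.symm⟩

theorem dualEquiv_bInvA (φ : Dual E) (x : E) : dualEquiv (bInvA h.dual φ) x
    = X * derivative ℂ (dualEquiv φ x) - dualEquiv φ (bInvA h x) := by
  have h1 := dualEquiv_a_eq_neg_X_mul h φ x
  rw [← X_smul_bInvA h.dual, dualEquiv_smul, evalNegHom_X] at h1
  exact mul_left_cancel₀ (neg_ne_zero.2 X_ne_zero) h1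

theorem bInvA_dual_sub_mem_iff (φ : Dual E) (μ : ℂ) :
    bInvA h.dual φ - μ • φ ∈ bE (Dual E) ↔
      ∀ x, constantCoeff (dualEquiv φ (bInvA h x)) = -μ * constantCoeff (dualEquiv φ x) := by
  rw [mem_bE_dual_iff]
  refine forall_congr' fun x => ?_
  rw [map_sub, dualEquiv_smul_complex, LinearMap.sub_apply, LinearMap.smul_apply,
    dualEquiv_bInvA, smul_eq_C_mul]
  simp only [map_sub, map_mul, constantCoeff_X, zero_mul, zero_sub, constantCoeff_C]
  rw [sub_eq_zero, neg_eq_iff_eq_neg, neg_mul]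

/-- The dual modulo `b` is the dual vector space of `E / bE`, on which `b⁻¹a` acts as minus the
transpose. -/
theorem mem_spec_dual_iff {μ : ℂ} : μ ∈ spec h.dual ↔ -μ ∈ spec h := by
  constructor
  · intro hμ
    by_contra hn
    obtain ⟨φ, hφ, hφ'⟩ := (mem_spec_iff _).1 hμ
    rw [bInvA_dual_sub_mem_iff h] at hφ'
    refine hφ (mem_bE_dual_iff.2 fun w => ?_)
    -- Every `w` is `(b⁻¹a + μ) y` modulo `b`, and `φ` vanishes modulo `b` on such elements.
    obtain ⟨y, hy⟩ := exists_of_notMem_spec h hn w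
    obtain ⟨z, hz⟩ := mem_bE.1 hy
    have hw : w = bInvA h y - (C (-μ) : ℂ⟦X⟧) • y - (X : ℂ⟦X⟧) • z := by
      rw [hz, C_smul]; abel
    simp only [hw, map_sub, LinearMap.map_smul, hφ', smul_eq_mul, map_mul, constantCoeff_C,
      constantCoeff_X]
    ring
  · intro hμ
    obtain ⟨f, hf, hfb, hfa⟩ := exists_form_of_mem_spec h hμ
    let B := Module.Free.chooseBasis ℂ⟦X⟧ E
    -- The form `f` lifts by taking constant series as values on a basis.
    let φ : Dual E := dualEquiv.symm (B.constr ℂ⟦X⟧ fun i => C (f (B i)))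
    have hφ : ∀ x, constantCoeff (dualEquiv φ x) = f x := by
      intro x
      have hfs : ∀ (S : ℂ⟦X⟧) (y : E), f (S • y) = constantCoeff S * f y := by
        intro S y
        have := hfb _ (smul_sub_constantCoeff_smul_mem_bE S y)
        rwa [map_sub, map_smul f (constantCoeff S) y, sub_eq_zero] at this
      conv_rhs => rw [← B.sum_repr x]
      rw [AddEquiv.apply_symm_apply, Module.Basis.constr_apply_fintype]
      simp only [map_sum, hfs, B.equivFun_apply, smul_eq_mul, map_mul, constantCoeff_C]
    refine (mem_spec_iff _).2 ⟨φ, fun hb => hf ?_, (bInvA_dual_sub_mem_iff h _ _).2 fun x => ?_⟩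
    · ext x
      rw [← hφ, mem_bE_dual_iff.1 hb, LinearMap.zero_apply]
    · rw [hφ, hφ, hfa]

theorem lamMax_eq_classSup_spec (c : CModZ) :
    lamMax E c = classSup {lam : ℂ | lam ∈ spec h ∧ (lam : CModZ) = c} := by
  rw [← ExtComplex.neg_neg (lamMax E c), ← lamMin_dual, lamMin_eq_classInf_spec h.dual,
    ← ExtComplex.neg_neg (classSup _), ← classInf_neg (c := c) fun z hz => hz.2]
  congr 3
  ext z
  simp only [Set.mem_ofPred_eq]
  rw [mem_spec_dual_iff, QuotientAddGroup.mk_neg, neg_eq_iff_eq_neg]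

end SimplePole

/-! ### Simple pole lattices of regular (a,b)-modules -/

section Lattice

/-- The identity `ab = b(a + b)` on fractions `x / s`, after clearing denominators; `u` stands for
`a x` and `d` for `b² s'`. -/
theorem leibniz_fraction {R M : Type*} [CommRing R] [AddCommGroup M] [Module R M]
    (b s d : R) (u x : M) :
    (s * s * (s * s)) • (s • (b ^ 2 • x + b • u) - d • b • x)
      = (s * s) • b • ((s * s) • (s • u - d • x) + (s * s) • s • b • x) := by module

theorem pow_smul_add_sub_cancel {R M : Type*} [CommRing R] [AddCommGroup M] [Module R M]
    (b m : R) (n : ℕ) (u v : M) :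
    b ^ n • u + (m * b ^ (n + 1)) • v - (m * b) • b ^ n • v = b ^ n • u := by module

variable {E : Type*}
  [AddCommGroup E] [Module ℂ E] [Module ℂ⟦X⟧ E] [IsScalarTower ℂ ℂ⟦X⟧ E] [ABModule E]

variable (E) in
/-- The inclusion of `E` in `E[b⁻¹]`. -/
abbrev toLoc : E →ₗ[ℂ⟦X⟧] Loc E :=
  LocalizedModule.mkLinearMap (Submonoid.powers (X : ℂ⟦X⟧)) E

theorem toLoc_injective : Function.Injective (toLoc E) := by
  intro x y h
  obtain ⟨⟨u, n, rfl⟩, hu⟩ := LocalizedModule.mk_eq.1 h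
  simp only [one_smul, Submonoid.smul_def] at hu
  exact smul_right_injective E (pow_ne_zero n X_ne_zero) hu

theorem exists_X_pow_smul_eq_toLoc (z : Loc E) :
    ∃ (n : ℕ) (x : E), (X : ℂ⟦X⟧) ^ n • z = toLoc E x := by
  induction z using LocalizedModule.induction_on with
  | h x s =>
    obtain ⟨s, n, rfl⟩ := s
    refine ⟨n, x, ?_⟩
    rw [LocalizedModule.smul'_mk, LocalizedModule.mkLinearMap_apply, LocalizedModule.mk_eq]
    exact ⟨1, by simp [Submonoid.smul_def]⟩

theorem aLoc_toLoc (x : E) : aLoc (toLoc E x) = toLoc E (ABModule.a x) := by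
  rw [LocalizedModule.mkLinearMap_apply, aLoc_mk, LocalizedModule.mkLinearMap_apply]
  simp

theorem aLoc_X_smul (z : Loc E) :
    aLoc ((X : ℂ⟦X⟧) • z) = (X : ℂ⟦X⟧) • (aLoc z + (X : ℂ⟦X⟧) • z) := by
  induction z using LocalizedModule.induction_on with
  | h x s =>
    have hc := ABModule.commutation x
    rw [sub_eq_iff_eq_add] at hc
    rw [LocalizedModule.smul'_mk, aLoc_mk, aLoc_mk, hc,
      ← LocalizedModule.mk_cancel_common_left s s ((X : ℂ⟦X⟧) • x),
      LocalizedModule.mk_add_mk, LocalizedModule.smul'_mk, LocalizedModule.mk_eq]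
    refine ⟨1, ?_⟩
    simp only [Submonoid.smul_def, one_smul, Submonoid.coe_mul]
    exact leibniz_fraction _ _ _ _ _

theorem X_smul_bInvALoc (z : Loc E) : (X : ℂ⟦X⟧) • bInvALoc z = aLoc z :=
  LocalizedModule.mul_by_divBy (⟨X, Submonoid.mem_powers X⟩ : Submonoid.powers (X : ℂ⟦X⟧)) _

theorem bInvALoc_X_smul (z : Loc E) :
    bInvALoc ((X : ℂ⟦X⟧) • z) = (X : ℂ⟦X⟧) • (bInvALoc z + z) := by
  have := LocalizedModule.divBy_mul_by
    (⟨X, Submonoid.mem_powers X⟩ : Submonoid.powers (X : ℂ⟦X⟧)) (aLoc z + (X : ℂ⟦X⟧) • z)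
  rw [Module.algebraMap_end_apply] at this
  rw [bInvALoc, aLoc_X_smul, this, smul_add, X_smul_bInvALoc]

theorem bInvALoc_X_pow_smul (n : ℕ) (z : Loc E) :
    bInvALoc ((X : ℂ⟦X⟧) ^ n • z) = (X : ℂ⟦X⟧) ^ n • (bInvALoc z + n • z) := by
  induction n with
  | zero => simp
  | succ n ih =>
    rw [pow_succ', mul_smul, bInvALoc_X_smul, ih, mul_smul, ← smul_add, succ_nsmul, add_assoc]

theorem toLoc_mem_saturation (x : E) : toLoc E x ∈ saturation E :=
  Submodule.mem_sInf.2 fun _ hN => hN.1 (LinearMap.mem_range_self _ x)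

theorem bInvALoc_mem_saturation {z : Loc E} (hz : z ∈ saturation E) :
    bInvALoc z ∈ saturation E :=
  Submodule.mem_sInf.2 fun N hN => hN.2 z (Submodule.mem_sInf.1 hz N hN)

/-- A regular (a,b)-module contains a simple pole sub-(a,b)-module of finite colength. -/
theorem IsRegular.exists_lattice (hE : IsRegular E) :
    ∃ (F : Submodule ℂ⟦X⟧ E) (N : ℕ),
      (∀ x ∈ F, ∃ y ∈ F, ABModule.a x = (X : ℂ⟦X⟧) • y) ∧ ∀ x, (X : ℂ⟦X⟧) ^ N • x ∈ F := by
  obtain ⟨s, hs⟩ := hE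
  choose d v hv using exists_X_pow_smul_eq_toLoc (E := E)
  -- A common denominator for the generators, hence for the whole saturation.
  set N := s.sup d
  have hN : ∀ z ∈ saturation E, ∃ x, (X : ℂ⟦X⟧) ^ N • z = toLoc E x := by
    intro z hz
    rw [← hs] at hz
    induction hz using Submodule.span_induction with
    | mem z hz =>
      refine ⟨(X : ℂ⟦X⟧) ^ (N - d z) • v z, ?_⟩
      rw [map_smul, ← hv, smul_smul, ← pow_add, Nat.sub_add_cancel (Finset.le_sup hz)]
    | zero => exact ⟨0, by simp⟩
    | add z w _ _ hz hw =>
      obtain ⟨x, hx⟩ := hz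
      obtain ⟨y, hy⟩ := hw
      exact ⟨x + y, by rw [smul_add, hx, hy, map_add]⟩
    | smul S z _ hz =>
      obtain ⟨x, hx⟩ := hz
      exact ⟨S • x, by rw [smul_comm, hx, map_smul]⟩
  -- The submodule is `b^N` times the saturation, which lies in `E` by `hN` and inherits stability
  -- under `b⁻¹a`.
  refine ⟨((saturation E).map (LinearMap.lsmul ℂ⟦X⟧ (Loc E) (X ^ N))).comap (toLoc E), N, ?_, ?_⟩
  · rintro x ⟨z, hz, hzx : (X : ℂ⟦X⟧) ^ N • z = toLoc E x⟩
    have hz' : bInvALoc z + N • z ∈ saturation E :=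
      add_mem (bInvALoc_mem_saturation hz) (nsmul_mem hz N)
    obtain ⟨y, hy⟩ := hN _ hz'
    refine ⟨y, ⟨_, hz', hy⟩, toLoc_injective ?_⟩
    rw [← aLoc_toLoc, ← hzx, ← X_smul_bInvALoc, bInvALoc_X_pow_smul, hy, map_smul]
  · intro x
    exact ⟨toLoc E x, toLoc_mem_saturation x, (map_smul (toLoc E) _ _).symm⟩

/-- A sub-`ℂ⟦b⟧`-module stable by `a` is an (a,b)-module. -/
abbrev ABModule.ofStable (F : Submodule ℂ⟦X⟧ E) (hF : ∀ x ∈ F, ABModule.a x ∈ F) :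
    ABModule F :=
  let aF : F →ₗ[ℂ] F :=
    { toFun := fun x => ⟨ABModule.a (x : E), hF x x.2⟩
      map_add' := fun x y => Subtype.ext (map_add ABModule.a (x : E) y)
      map_smul' := fun c x => Subtype.ext (map_smul ABModule.a c (x : E)) }
  have hc : ∀ x : F, aF ((X : ℂ⟦X⟧) • x) - (X : ℂ⟦X⟧) • aF x = (X : ℂ⟦X⟧) ^ 2 • x := fun x =>
    Subtype.ext (ABModule.commutation (x : E))
  { free := inferInstance
    finite := inferInstance
    a := aF
    continuous_a := continuous_of_commutation aF hc
    commutation := hc }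

end Lattice

/-! ### Bounds for the morphisms from and to `E_λ` -/

section Bounds

variable {E : Type*}
  [AddCommGroup E] [Module ℂ E] [Module ℂ⟦X⟧ E] [IsScalarTower ℂ ℂ⟦X⟧ E] [ABModule E]

theorem IsSimplePole.exists_le_re (h : IsSimplePole E) :
    ∃ r : ℝ, ∀ lam : ℂ, HasNonzeroMorphism (Elam lam) E → r ≤ lam.re := by
  obtain ⟨r, hr⟩ := ((spec_finite h).image Complex.re).bddBelow
  refine ⟨r, fun lam hlam => ?_⟩
  obtain ⟨k, hk⟩ := exists_sub_nat_mem_spec h hlam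
  refine (hr (Set.mem_image_of_mem _ hk)).trans ?_
  simp

theorem IsSimplePole.exists_re_le (h : IsSimplePole E) :
    ∃ r : ℝ, ∀ lam : ℂ, HasNonzeroMorphism E (Elam lam) → lam.re ≤ r := by
  obtain ⟨r, hr⟩ := h.dual.exists_le_re
  refine ⟨-r, fun lam hlam => ?_⟩
  have := hr _ (hasNonzeroMorphism_Elam_right_iff_dual.1 hlam)
  rw [Complex.neg_re] at this
  linarith

theorem lamMin_eq_posInf_iff {c : CModZ} : lamMin E c = .posInf ↔
    ∀ lam : ℂ, (lam : CModZ) = c → ¬HasNonzeroMorphism (Elam lam) E := by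
  rw [lamMin, classInf_eq_posInf_iff, Set.eq_empty_iff_forall_notMem]
  exact forall_congr' fun lam => not_and

theorem lamMax_eq_negInf_iff {c : CModZ} : lamMax E c = .negInf ↔
    ∀ lam : ℂ, (lam : CModZ) = c → ¬HasNonzeroMorphism E (Elam lam) := by
  rw [lamMax, classSup_eq_negInf_iff, Set.eq_empty_iff_forall_notMem]
  exact forall_congr' fun lam => not_and

theorem IsSimplePole.lamMin_eq_posInf_iff_lamMax (h : IsSimplePole E) (c : CModZ) :
    lamMin E c = .posInf ↔ lamMax E c = .negInf := by
  rw [lamMin_eq_classInf_spec h, lamMax_eq_classSup_spec h, classInf_eq_posInf_iff,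
    classSup_eq_negInf_iff]

/-! ### Transfer of morphisms between `E` and a submodule containing `b^N E` -/

section Transfer

variable {F : Submodule ℂ⟦X⟧ E} [ABModule F]
  {lam : ℂ} {N : ℕ}

theorem hasNonzeroMorphism_of_submodule
    (ha : ∀ x : F, ((ABModule.a x : F) : E) = ABModule.a (x : E))
    (hF : HasNonzeroMorphism (Elam lam) F) :
    HasNonzeroMorphism (Elam lam) E := by
  rw [hasNonzeroMorphism_Elam_left_iff] at hF ⊢
  obtain ⟨x, hx, hax⟩ := hF
  exact ⟨x, by simpa using hx, by rw [← ha, hax]; rfl⟩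

/-- Multiplication by `b^N` carries a solution into `F` and adds `N` to `λ`. -/
theorem hasNonzeroMorphism_submodule
    (ha : ∀ x : F, ((ABModule.a x : F) : E) = ABModule.a (x : E))
    (hN : ∀ x : E, (X : ℂ⟦X⟧) ^ N • x ∈ F)
    (hE : HasNonzeroMorphism (Elam lam) E) :
    HasNonzeroMorphism (Elam (lam + N)) F := by
  rw [hasNonzeroMorphism_Elam_left_iff] at hE ⊢
  obtain ⟨x, hx, hax⟩ := hE
  refine ⟨⟨_, hN x⟩, fun h => hx ?_, Subtype.ext ?_⟩
  · exact smul_right_injective E (pow_ne_zero N X_ne_zero)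
      ((congrArg Subtype.val h).trans (smul_zero _).symm)
  · rw [ha]
    change ABModule.a ((X : ℂ⟦X⟧) ^ N • x) = (lam + N) • (X : ℂ⟦X⟧) • (X : ℂ⟦X⟧) ^ N • x
    rw [map_X_pow_smul _ ABModule.commutation, hax, add_smul, smul_comm _ lam, smul_smul,
      smul_smul, ← pow_succ, ← pow_succ', Nat.cast_smul_eq_nsmul, ← nsmul_eq_mul, smul_assoc]

theorem hasNonzeroMorphism_restrict
    (ha : ∀ x : F, ((ABModule.a x : F) : E) = ABModule.a (x : E))
    (hN : ∀ x : E, (X : ℂ⟦X⟧) ^ N • x ∈ F)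
    (hE : HasNonzeroMorphism E (Elam lam)) :
    HasNonzeroMorphism F (Elam lam) := by
  rw [hasNonzeroMorphism_Elam_right_iff] at hE ⊢
  obtain ⟨φ, hφ, hφa⟩ := hE
  refine ⟨φ ∘ₗ F.subtype, fun h => hφ ?_, fun x => ?_⟩
  · ext1 x
    have := LinearMap.congr_fun h ⟨_, hN x⟩
    rw [LinearMap.comp_apply, Submodule.subtype_apply, map_smul, LinearMap.zero_apply,
      smul_eq_zero] at this
    exact this.resolve_left (pow_ne_zero N X_ne_zero)
  · simp only [LinearMap.comp_apply, Submodule.subtype_apply, ha, hφa]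

/-- The morphism is precomposed with `b^N : E → F`, which commutes with `a` up to `N b^(N+1)`; this
defect lowers `λ` by `N`. -/
theorem hasNonzeroMorphism_extend
    (ha : ∀ x : F, ((ABModule.a x : F) : E) = ABModule.a (x : E))
    (hN : ∀ x : E, (X : ℂ⟦X⟧) ^ N • x ∈ F)
    (hF : HasNonzeroMorphism F (Elam lam)) :
    HasNonzeroMorphism E (Elam (lam - N)) := by
  rw [hasNonzeroMorphism_Elam_right_iff] at hF ⊢
  obtain ⟨φ, hφ, hφa⟩ := hF
  let ι : E →ₗ[ℂ⟦X⟧] F := LinearMap.codRestrict F (LinearMap.lsmul ℂ⟦X⟧ E (X ^ N)) hN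
  have hι : ∀ x, ((ι x : F) : E) = (X : ℂ⟦X⟧) ^ N • x := fun x => rfl
  refine ⟨φ ∘ₗ ι, fun h => hφ ?_, fun x => ?_⟩
  · ext1 x
    have := LinearMap.congr_fun h (x : E)
    have hx : ι x = (X : ℂ⟦X⟧) ^ N • x := Subtype.ext (hι x)
    rw [LinearMap.comp_apply, hx, map_smul, LinearMap.zero_apply, smul_eq_zero] at this
    exact this.resolve_left (pow_ne_zero N X_ne_zero)
  · have hx : ι (ABModule.a x) = ABModule.a (ι x) - ((N : ℂ⟦X⟧) * X) • ι x := by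
      apply Subtype.ext
      rw [Submodule.coe_sub, Submodule.coe_smul, ha, hι, hι,
        map_X_pow_smul _ ABModule.commutation, pow_smul_add_sub_cancel]
    rw [LinearMap.comp_apply, hx, map_sub, hφa, map_smul, LinearMap.comp_apply]
    simp only [smul_eq_C_mul, smul_eq_mul, map_sub, map_natCast]
    ring

end Transfer

/-- The invariants `λ̃_min` and `λ̃_max` of a regular (a,b)-module are finite simultaneously. -/
theorem IsRegular.lamMin_lamMax (hE : IsRegular E) (c : CModZ) :
    lamMin E c ≠ .negInf ∧ lamMax E c ≠ .posInf ∧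
      (lamMin E c ≠ .posInf ↔ lamMax E c ≠ .negInf) := by
  obtain ⟨F, N, hF, hN⟩ := hE.exists_lattice
  let _ : ABModule F := ABModule.ofStable F fun x hx => by
    obtain ⟨y, hy, hxy⟩ := hF x hx
    exact hxy ▸ F.smul_mem _ hy
  have ha : ∀ x : F, ((ABModule.a x : F) : E) = ABModule.a (x : E) := fun x => rfl
  have h : IsSimplePole F := fun x => by
    obtain ⟨y, hy, hxy⟩ := hF x x.2
    exact ⟨⟨y, hy⟩, Subtype.ext hxy⟩
  refine ⟨?_, ?_, not_congr ?_⟩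
  · obtain ⟨r, hr⟩ := h.exists_le_re
    refine classInf_ne_negInf (c := c) (r := r - N) (fun z hz => hz.1) fun z hz => ?_
    have := hr _ (hasNonzeroMorphism_submodule ha hN hz.2)
    simp only [Complex.add_re, Complex.natCast_re] at this
    linarith
  · obtain ⟨r, hr⟩ := h.exists_re_le
    intro h0
    -- The upper bound is handled as a lower bound for the opposite set.
    refine classInf_ne_negInf (c := -c) (r := -r)
      (S := {z | -z ∈ {lam : ℂ | (lam : CModZ) = c ∧ HasNonzeroMorphism E (Elam lam)}})
      (fun z hz => ?_) (fun z hz => ?_) ?_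
    · rw [← hz.1, QuotientAddGroup.mk_neg, neg_neg]
    · have := hr _ (hasNonzeroMorphism_restrict ha hN hz.2)
      rw [Complex.neg_re] at this
      linarith
    · rw [classInf_neg (c := c) fun z hz => hz.1]
      exact congrArg Neg.neg h0
  -- For `F` both conditions say that the spectrum misses the class; the shifts by `N` stay in the
  -- class, so each condition is equivalent for `E` and `F`.
  · trans lamMin F c = .posInf
    · rw [lamMin_eq_posInf_iff, lamMin_eq_posInf_iff]
      exact ⟨fun hE z hz hF => hE z hz (hasNonzeroMorphism_of_submodule ha hF),
        fun hF z hz hE => hF _ ((mk_add_nat z N).trans hz)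
          (hasNonzeroMorphism_submodule ha hN hE)⟩
    · rw [h.lamMin_eq_posInf_iff_lamMax, lamMax_eq_negInf_iff, lamMax_eq_negInf_iff]
      exact ⟨fun hF z hz hE => hF z hz (hasNonzeroMorphism_restrict ha hN hE),
        fun hE z hz hF => hE _ ((mk_sub_nat z N).trans hz)
          (hasNonzeroMorphism_extend ha hN hF)⟩

end Bounds

end AB

end

theorem mainTheorem7 (E : Type*) [AddCommGroup E] [Module ℂ E] [Module ℂ⟦X⟧ E]
    [IsScalarTower ℂ ℂ⟦X⟧ E] [AB.ABModule E] :
    (∀ h : AB.IsSimplePole E, ∀ c : AB.CModZ,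
      AB.lamMin E c = AB.classInf {lam : ℂ | lam ∈ AB.spec h ∧ (lam : AB.CModZ) = c} ∧
      AB.lamMax E c = AB.classSup {lam : ℂ | lam ∈ AB.spec h ∧ (lam : AB.CModZ) = c}) ∧
    (AB.IsRegular E →
      (∀ c : AB.CModZ,
        AB.lamMax (AB.Dual E) (-c) = -AB.lamMin E c ∧
        AB.lamMin (AB.Dual E) (-c) = -AB.lamMax E c ∧
        AB.widthAt (AB.Dual E) (-c) = AB.widthAt E c) ∧
      AB.width (AB.Dual E) = AB.width E ∧
      (∀ c : AB.CModZ,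
        AB.lamMin E c ≠ AB.ExtComplex.negInf ∧
        AB.lamMax E c ≠ AB.ExtComplex.posInf ∧
        (AB.lamMin E c ≠ AB.ExtComplex.posInf ↔ AB.lamMax E c ≠ AB.ExtComplex.negInf))) :=
  ⟨fun h c => ⟨AB.lamMin_eq_classInf_spec h c, AB.lamMax_eq_classSup_spec h c⟩,
    fun hE => ⟨fun c => ⟨AB.lamMax_dual c, AB.lamMin_dual c, AB.widthAt_dual c⟩, AB.width_dual,
      fun c => hE.lamMin_lamMax c⟩⟩
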